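/- Let $n\ge 2$, let $\mathfrak g=\mathfrak{sp}(2n,\mathbb C)$ with Lie bracket $[\cdot,\cdot]$ and Killing form $\langle\cdot,\cdot\rangle$, and let $\mathfrak g\circledcirc\mathfrak g\subset\mathfrak g\otimes\mathfrak g$ be the Cartan product of $\mathfrak g$ with itself, that is, the unique irreducible component of $\mathfrak g\otimes\mathfrak g$ whose highest weight is twice the highest weight of $\mathfrak g$. For $X,Y\in\mathfrak g$ let $X\circledcirc Y\in\mathfrak g\circledcirc\mathfrak g$ denote the image of $X\otimes Y$ under the $\mathfrak g$-invariant projection of $\mathfrak g\otimes\mathfrak g$ onto $\mathfrak g\circledcirc\mathfrak g$. Let $\lambda\in\mathbb C$ with $\lambda\neq-\frac{1}{16(n+1)}$. Then the two-sided ideal of the full tensor algebra $\bigotimes\mathfrak g$ generated by the elements $$X\otimes Y-X\circledcirc Y-\tfrac12[X,Y]-\lambda\langle X,Y\rangle\in\textstyle\bigotimes^2\mathfrak g\oplus\mathfrak g\oplus\mathbb C,\qquad X,Y\in\mathfrak g,$$ contains $\mathfrak g$, the first graded piece of $\bigotimes\mathfrak g$. -/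

import Mathlib

open scoped TensorProduct

noncomputable section

/-- The complex symplectic Lie algebra `sp(2n, ℂ)`. -/
abbrev SpC (n : ℕ) : Type := LieAlgebra.Symplectic.sp (Fin n) ℂ

/-- The standard Cartan subalgebra of `sp(2n, ℂ)`: the diagonal matrices. -/
def spCartan (n : ℕ) : Submodule ℂ (SpC n) where
  carrier := {X | ∀ a b, a ≠ b → X.1 a b = 0}
  zero_mem' := fun _ _ _ => rfl
  add_mem' := fun {X Y} hX hY a b hab => by
    change X.1 a b + Y.1 a b = 0
    rw [hX a b hab, hY a b hab, add_zero]
  smul_mem' := fun r X hX a b hab => by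
    change r * X.1 a b = 0
    rw [hX a b hab, mul_zero]

/-- The sum of the positive root spaces of `sp(2n, ℂ)` with respect to `spCartan n`, for the
standard positive roots `εᵢ - εⱼ` (`i < j`), `εᵢ + εⱼ` and `2 εᵢ`: the matrices
`[[A, B], [0, -Aᵀ]]` in `sp(2n, ℂ)` with `A` strictly upper triangular. -/
def spPos (n : ℕ) : Submodule ℂ (SpC n) where
  carrier := {X | (∀ i j, X.1 (Sum.inr i) (Sum.inl j) = 0) ∧
    ∀ i j, j ≤ i → X.1 (Sum.inl i) (Sum.inl j) = 0}
  zero_mem' := ⟨fun _ _ => rfl, fun _ _ _ => rfl⟩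
  add_mem' := fun {X Y} hX hY => by
    refine ⟨fun i j => ?_, fun i j hij => ?_⟩
    · change X.1 _ _ + Y.1 _ _ = 0
      rw [hX.1, hY.1, add_zero]
    · change X.1 _ _ + Y.1 _ _ = 0
      rw [hX.2 i j hij, hY.2 i j hij, add_zero]
  smul_mem' := fun r X hX => by
    refine ⟨fun i j => ?_, fun i j hij => ?_⟩
    · change r * X.1 _ _ = 0
      rw [hX.1, mul_zero]
    · change r * X.1 _ _ = 0
      rw [hX.2 i j hij, mul_zero]

/-- `χ` is a highest weight of the representation `M` of `sp(2n, ℂ)`: there is a nonzero vector of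
weight `χ` that is annihilated by all positive root vectors. (An irreducible finite-dimensional
`M` has exactly one highest weight.) -/
def HasHighestWeight (n : ℕ) (M : Type*) [AddCommGroup M] [Module ℂ M] [LieRingModule (SpC n) M]
    (χ : Module.Dual ℂ (spCartan n)) : Prop :=
  ∃ v : M, v ≠ 0 ∧ (∀ h : spCartan n, ⁅(h : SpC n), v⁆ = χ h • v) ∧
    ∀ x ∈ spPos n, ⁅x, v⁆ = 0

/-- `C` is the Cartan product of `g = sp(2n, ℂ)` with itself: an irreducible component of `g ⊗ g`
whose highest weight is twice the highest weight of `g`. -/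
def IsCartanProduct (n : ℕ) (C : LieSubmodule ℂ (SpC n) (SpC n ⊗[ℂ] SpC n)) : Prop :=
  LieModule.IsIrreducible ℂ (SpC n) C ∧
    ∃ χ : Module.Dual ℂ (spCartan n),
      HasHighestWeight n (SpC n) χ ∧ HasHighestWeight n C ((2 : ℂ) • χ)

/-- `P` is an invariant (that is, `g`-equivariant) projection of `g ⊗ g` onto the Cartan product,
for `g = sp(2n, ℂ)`. -/
def IsCartanProjection (n : ℕ)
    (P : SpC n ⊗[ℂ] SpC n →ₗ⁅ℂ, SpC n⁆ SpC n ⊗[ℂ] SpC n) : Prop :=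
  ∃ C : LieSubmodule ℂ (SpC n) (SpC n ⊗[ℂ] SpC n),
    IsCartanProduct n C ∧ LinearMap.IsProj C.toSubmodule P

/-- Let `L` act on `M` so that the adjoint of each element of `L` again comes from `L`, and let `v`
span an eigenspace of a self-adjoint element. Then the submodule generated by `v` is irreducible,
and there is exactly one equivariant projection onto it. -/
theorem SpAux.lieIrr_of_star {L M : Type*} [LieRing L] [LieAlgebra ℂ L]
    [AddCommGroup M] [Module ℂ M] [FiniteDimensional ℂ M] [LieRingModule L M] [LieModule ℂ L M]
    (c : InnerProductSpace.Core ℂ M) (st : L → L)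
    (hst : ∀ x m m', c.inner ⁅x, m⁆ m' = c.inner m ⁅st x, m'⁆)
    (v : M) (hv : v ≠ 0) (h : L) (μ : ℂ) (hh : st h = h) (hvμ : ⁅h, v⁆ = μ • v)
    (huniq : ∀ m : M, ⁅h, m⁆ = μ • m → ∃ a : ℂ, m = a • v) :
    LieModule.IsIrreducible ℂ L (LieSubmodule.lieSpan ℂ L {v}) ∧
    ∃! P : M →ₗ⁅ℂ, L⁆ M, LinearMap.IsProj (LieSubmodule.lieSpan ℂ L {v} : LieSubmodule ℂ L M).toSubmodule P := by
  let _ : NormedAddCommGroup M := c.toNormedAddCommGroup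
  let _ : InnerProductSpace ℂ M := InnerProductSpace.ofCore c.toCore
  have hst' : ∀ (x : L) (m m' : M), inner ℂ ⁅x, m⁆ m' = inner ℂ m ⁅st x, m'⁆ := hst
  -- orthogonal complements are submodules
  have hperp : ∀ (W : LieSubmodule ℂ L M) (x : L) (m : M), m ∈ W.toSubmoduleᗮ →
      ⁅x, m⁆ ∈ W.toSubmoduleᗮ := by
    intro W x m hm
    rw [Submodule.mem_orthogonal'] at hm ⊢
    intro u hu
    rw [hst']
    exact hm _ (W.lie_mem hu)
  have hdec : ∀ (W : LieSubmodule ℂ L M) (m : M), ∃ a ∈ W, ∃ b ∈ W.toSubmoduleᗮ, m = a + b := by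
    intro W m
    refine ⟨W.toSubmodule.starProjection m, Submodule.starProjection_apply_mem _ _, m - W.toSubmodule.starProjection m,
      Submodule.sub_starProjection_mem_orthogonal _, by abel⟩
  have hdisj : ∀ (W : LieSubmodule ℂ L M) (m : M), m ∈ W → m ∈ W.toSubmoduleᗮ → m = 0 := by
    intro W m h1 h2
    exact (Submodule.disjoint_def.1 (Submodule.orthogonal_disjoint W.toSubmodule)) m h1 h2
  -- every submodule contains the vector or is orthogonal to it
  have hdich : ∀ W : LieSubmodule ℂ L M, v ∈ W ∨ v ∈ W.toSubmoduleᗮ := by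
    intro W
    obtain ⟨a, ha, b, hb, hab⟩ := hdec W v
    have h1 : ⁅h, a⁆ - μ • a + (⁅h, b⁆ - μ • b) = 0 := by
      have : ⁅h, a + b⁆ = μ • (a + b) := by rw [← hab, hvμ]
      rw [lie_add, smul_add] at this
      rw [sub_add_sub_comm, this, sub_self]
    have h2 : ⁅h, a⁆ - μ • a = 0 := by
      apply hdisj W
      · exact sub_mem (W.lie_mem ha) (W.smul_mem _ ha)
      · rw [eq_neg_of_add_eq_zero_left h1]
        exact neg_mem (sub_mem (hperp W _ _ hb) (Submodule.smul_mem _ _ hb))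
    obtain ⟨r, hr⟩ := huniq a (sub_eq_zero.1 h2)
    by_cases hr0 : r = 0
    · right
      rw [hr0, zero_smul] at hr
      rw [hab, hr, zero_add]
      exact hb
    · left
      have : v = r⁻¹ • a := by rw [hr, smul_smul, inv_mul_cancel₀ hr0, one_smul]
      rw [this]
      exact W.smul_mem _ ha
  set C : LieSubmodule ℂ L M := LieSubmodule.lieSpan ℂ L {v} with hC
  have hvC : v ∈ C := LieSubmodule.subset_lieSpan rfl
  have hCle : ∀ W : LieSubmodule ℂ L M, v ∈ W → C ≤ W := fun W hW =>
    LieSubmodule.lieSpan_le.2 (by simpa using hW)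
  have hCperp : ∀ W : LieSubmodule ℂ L M, v ∈ W.toSubmoduleᗮ → ∀ u ∈ C, u ∈ W.toSubmoduleᗮ := by
    intro W hW u hu
    let Wp : LieSubmodule ℂ L M := { W.toSubmoduleᗮ with lie_mem := fun {x m} hm => hperp W x m hm }
    exact hCle Wp hW hu
  refine ⟨?_, ?_⟩
  · have : Nontrivial C := ⟨⟨⟨v, hvC⟩, 0, fun h0 => hv (congrArg Subtype.val h0)⟩⟩
    refine LieModule.IsIrreducible.mk fun N hN => ?_
    rcases hdich (N.map C.incl) with hW | hW
    · rw [eq_top_iff]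
      rintro ⟨u, hu⟩ -
      have := hCle _ hW hu
      rw [LieSubmodule.mem_map] at this
      obtain ⟨y, hy, hyu⟩ := this
      have : y = ⟨u, hu⟩ := Subtype.ext hyu
      exact this ▸ hy
    · exfalso
      apply hN
      rw [eq_bot_iff]
      intro y hy
      have h1 := hCperp _ hW y.1 y.2
      have h2 : (y.1 : M) ∈ N.map C.incl := LieSubmodule.mem_map_of_mem hy
      have := hdisj _ _ h2 h1
      simpa using this
  · have hP : ∀ (x : L) (m : M), C.toSubmodule.starProjection ⁅x, m⁆ = ⁅x, C.toSubmodule.starProjection m⁆ := by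
      intro x m
      have h1 := C.toSubmodule.sub_starProjection_mem_orthogonal m
      have h2 : ⁅x, m⁆ - ⁅x, C.toSubmodule.starProjection m⁆ ∈ C.toSubmoduleᗮ := by
        rw [← lie_sub]
        exact hperp C x _ h1
      exact Submodule.eq_starProjection_of_mem_orthogonal
        (C.lie_mem (Submodule.starProjection_apply_mem _ _)) h2
    refine ⟨{ (C.toSubmodule.starProjection : M →L[ℂ] M).toLinearMap with map_lie' := fun {x m} => hP x m }, ⟨?_, ?_⟩, ?_⟩
    · intro x
      exact Submodule.starProjection_apply_mem _ _
    · intro x hx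
      exact Submodule.starProjection_eq_self_iff.2 hx
    · intro Q hQ
      -- the range of `1 - Q` lies in the complement
      have hker : ∀ u ∈ C.toSubmoduleᗮ, Q u = 0 := by
        intro u hu
        let Qc : M →ₗ[ℂ] M := Q.toLinearMap
        let W : LieSubmodule ℂ L M :=
          { carrier := {w | ∀ y ∈ C.toSubmoduleᗮ, inner ℂ (Q y) w = (0:ℂ)}
            zero_mem' := by intro y _; simp
            add_mem' := by
              intro a b ha hb y hy
              rw [inner_add_right, ha y hy, hb y hy, add_zero]
            smul_mem' := by
              intro r a ha y hy
              rw [inner_smul_right, ha y hy, mul_zero]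
            lie_mem := by
              intro x w hw y hy
              rw [← inner_conj_symm, hst', ← Q.map_lie, inner_conj_symm]
              exact hw _ (hperp C _ _ hy) }
        have hvW : v ∈ W := by
          have ha : ⁅h, LinearMap.adjoint Qc v⁆ = μ • LinearMap.adjoint Qc v := by
            refine ext_inner_left ℂ fun y => ?_
            rw [← inner_conj_symm, hst', hh, inner_conj_symm, LinearMap.adjoint_inner_right,
              inner_smul_right, LinearMap.adjoint_inner_right]
            change inner ℂ (Q ⁅h, y⁆) v = μ * inner ℂ (Q y) v
            rw [Q.map_lie, hst', hh, hvμ, inner_smul_right]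
          obtain ⟨r, hr⟩ := huniq _ ha
          intro y hy
          change inner ℂ (Qc y) v = (0 : ℂ)
          rw [← LinearMap.adjoint_inner_right, hr, inner_smul_right,
            (Submodule.mem_orthogonal' _ _).1 hy v hvC, mul_zero]
        have h2 := hCle W hvW (hQ.map_mem u) u hu
        exact inner_self_eq_zero.1 h2
      ext m
      obtain ⟨a, ha, b, hb, rfl⟩ := hdec C m
      have e1 : C.toSubmodule.starProjection a = a := Submodule.starProjection_eq_self_iff.2 ha
      have e2 : C.toSubmodule.starProjection b = 0 := (Submodule.starProjection_apply_eq_zero_iff _).2 hb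
      change Q (a + b) = C.toSubmodule.starProjection (a + b)
      rw [map_add, map_add, hQ.map_id a ha, hker b hb, e1, e2]

namespace SpAux

open Matrix
open scoped Kronecker ComplexOrder

variable {n : ℕ}

theorem mem_iff (A : Matrix (Fin n ⊕ Fin n) (Fin n ⊕ Fin n) ℂ) :
    A ∈ LieAlgebra.Symplectic.sp (Fin n) ℂ ↔ Aᵀ * J (Fin n) ℂ = J (Fin n) ℂ * (-A) := by
  rw [LieAlgebra.Symplectic.sp, mem_skewAdjointMatricesLieSubalgebra,
    mem_skewAdjointMatricesSubmodule]
  rfl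

theorem mem_iff_blocks (A B C D : Matrix (Fin n) (Fin n) ℂ) :
    fromBlocks A B C D ∈ LieAlgebra.Symplectic.sp (Fin n) ℂ ↔ D = -Aᵀ ∧ Bᵀ = B ∧ Cᵀ = C := by
  rw [mem_iff, J, fromBlocks_transpose, fromBlocks_neg, fromBlocks_multiply, fromBlocks_multiply,
    fromBlocks_inj]
  simp only [mul_zero, mul_one, mul_neg, neg_neg, zero_add, add_zero, zero_mul, one_mul, neg_mul,
    neg_zero]
  constructor
  · rintro ⟨h1, h2, h3, h4⟩
    exact ⟨h2.symm, neg_injective h4, h1⟩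
  · rintro ⟨h1, h2, h3⟩
    exact ⟨h3, h1.symm, by rw [h1]; simp, by rw [h2]⟩

theorem apply_rr (X : SpC n) (i j : Fin n) :
    X.1 (Sum.inr i) (Sum.inr j) = -X.1 (Sum.inl j) (Sum.inl i) := by
  have h := X.2
  rw [← fromBlocks_toBlocks X.1, mem_iff_blocks] at h
  exact congrFun (congrFun h.1 i) j

theorem apply_lr (X : SpC n) (i j : Fin n) :
    X.1 (Sum.inl i) (Sum.inr j) = X.1 (Sum.inl j) (Sum.inr i) := by
  have h := X.2
  rw [← fromBlocks_toBlocks X.1, mem_iff_blocks] at h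
  exact (congrFun (congrFun h.2.1 i) j).symm

theorem val_lie (X Y : SpC n) : (⁅X, Y⁆ : SpC n).1 = X.1 * Y.1 - Y.1 * X.1 := rfl

/-- The conjugate transpose on `sp(2n, ℂ)`. -/
def star (X : SpC n) : SpC n := ⟨X.1ᴴ, by
  have h := X.2
  rw [← fromBlocks_toBlocks X.1, mem_iff_blocks] at h
  rw [← fromBlocks_toBlocks X.1, fromBlocks_conjTranspose, mem_iff_blocks]
  refine ⟨?_, ?_, ?_⟩
  · rw [h.1]; ext i j; simp
  · ext i j
    have := congrFun (congrFun h.2.2 i) j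
    simp only [transpose_apply] at this
    simp [this]
  · ext i j
    have := congrFun (congrFun h.2.1 i) j
    simp only [transpose_apply] at this
    simp [this]⟩

/-- The inclusion in the space of matrices. -/
def val (n : ℕ) : SpC n →ₗ[ℂ] Matrix (Fin n ⊕ Fin n) (Fin n ⊕ Fin n) ℂ where
  toFun X := X.1
  map_add' _ _ := rfl
  map_smul' _ _ := rfl

theorem val_injective : Function.Injective (val n) := Subtype.val_injective

/-- Entries of a tensor in `g ⊗ g`. -/
def ent (n : ℕ) : SpC n ⊗[ℂ] SpC n →ₗ[ℂ]
    Matrix ((Fin n ⊕ Fin n) × (Fin n ⊕ Fin n)) ((Fin n ⊕ Fin n) × (Fin n ⊕ Fin n)) ℂ :=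
  (TensorProduct.lid ℂ ℂ).toLinearMap.mapMatrix ∘ₗ
    (kroneckerTMulLinearEquiv _ _ _ _ ℂ ℂ ℂ ℂ).toLinearMap ∘ₗ
      TensorProduct.map (val n) (val n)

theorem ent_tmul (X Y : SpC n) : ent n (X ⊗ₜ Y) = X.1 ⊗ₖ Y.1 := by
  ext ⟨a, b⟩ ⟨c, d⟩
  simp [ent, val]

theorem ent_injective : Function.Injective (ent n) := by
  have h1 : Function.Injective (TensorProduct.map (val n) (val n)) :=
    TensorProduct.map_injective_of_flat_flat _ _ val_injective val_injective
  have h2 : Function.Injective ((TensorProduct.lid ℂ ℂ).toLinearMap.mapMatrix :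
      Matrix ((Fin n ⊕ Fin n) × (Fin n ⊕ Fin n)) ((Fin n ⊕ Fin n) × (Fin n ⊕ Fin n)) (ℂ ⊗[ℂ] ℂ)
        →ₗ[ℂ] _) := by
    intro A B hAB
    ext a b
    apply (TensorProduct.lid ℂ ℂ).injective
    exact congrFun (congrFun hAB a) b
  exact h2.comp ((kroneckerTMulLinearEquiv (Fin n ⊕ Fin n) (Fin n ⊕ Fin n) (Fin n ⊕ Fin n)
    (Fin n ⊕ Fin n) ℂ ℂ ℂ ℂ).injective.comp h1)

/-- The action on `V ⊗ V`. -/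
def act (X : SpC n) :
    Matrix ((Fin n ⊕ Fin n) × (Fin n ⊕ Fin n)) ((Fin n ⊕ Fin n) × (Fin n ⊕ Fin n)) ℂ :=
  X.1 ⊗ₖ 1 + 1 ⊗ₖ X.1

theorem ent_lie (X : SpC n) (t : SpC n ⊗[ℂ] SpC n) :
    ent n ⁅X, t⁆ = act X * ent n t - ent n t * act X := by
  induction t using TensorProduct.induction_on with
  | zero => simp
  | tmul Y Z =>
    rw [TensorProduct.LieModule.lie_tmul_right, map_add, ent_tmul, ent_tmul, ent_tmul, act,
      val_lie, val_lie, add_mul, mul_add, ← mul_kronecker_mul, ← mul_kronecker_mul,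
      ← mul_kronecker_mul, ← mul_kronecker_mul, one_mul, mul_one, one_mul, mul_one]
    ext ⟨a, b⟩ ⟨c, d⟩
    simp only [Matrix.add_apply, Matrix.sub_apply, kronecker_apply]
    ring
  | add a b ha hb =>
    rw [lie_add, map_add, map_add, ha, hb, mul_add, add_mul]
    abel

theorem act_star (X : SpC n) : act (star X) = (act X)ᴴ := by
  simp [act, star, conjTranspose_kronecker]

/-- The Hermitian form on `g ⊗ g`. -/
abbrev core (n : ℕ) : InnerProductSpace.Core ℂ (SpC n ⊗[ℂ] SpC n) where
  inner t s := ((ent n t)ᴴ * ent n s).trace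
  conj_inner_symm t s := by
    rw [starRingEnd_apply, ← trace_conjTranspose, conjTranspose_mul, conjTranspose_conjTranspose]
  re_inner_nonneg t := by
    have := (posSemidef_conjTranspose_mul_self (ent n t)).trace_nonneg
    exact (Complex.le_def.1 this).1
  add_left t s u := by rw [map_add, conjTranspose_add, add_mul, trace_add]
  smul_left t s r := by
    rw [map_smul, conjTranspose_smul, smul_mul_assoc, trace_smul]
    rfl
  definite t ht := by
    apply ent_injective
    rw [map_zero]
    exact trace_conjTranspose_mul_self_eq_zero_iff.1 ht

theorem core_lie (X : SpC n) (t s : SpC n ⊗[ℂ] SpC n) :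
    (core n).inner ⁅X, t⁆ s = (core n).inner t ⁅star X, s⁆ := by
  change ((ent n ⁅X, t⁆)ᴴ * ent n s).trace = ((ent n t)ᴴ * ent n ⁅star X, s⁆).trace
  rw [ent_lie, ent_lie, act_star, conjTranspose_sub, conjTranspose_mul, conjTranspose_mul,
    sub_mul, mul_sub, trace_sub, trace_sub, mul_assoc, ← mul_assoc _ _ (act X)ᴴ,
    mul_assoc (act X)ᴴ, trace_mul_comm (act X)ᴴ, mul_assoc]

section

variable [NeZero n]

/-- The highest root vector. -/
def eVec (n : ℕ) [NeZero n] : SpC n :=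
  ⟨fromBlocks 0 (Matrix.single 0 0 1) 0 0, by rw [mem_iff_blocks]; simp⟩

/-- The coroot of the highest root. -/
def hVec (n : ℕ) [NeZero n] : SpC n :=
  ⟨fromBlocks (Matrix.single 0 0 1) 0 0 (-Matrix.single 0 0 1), by rw [mem_iff_blocks]; simp⟩

theorem eVec_val : (eVec n).1 = Matrix.single (Sum.inl 0) (Sum.inr 0) 1 := by
  ext (i | i) (j | j) <;> simp [eVec, Matrix.single_apply]

/-- Diagonal entries of `hVec`. -/
def hd (n : ℕ) [NeZero n] : Fin n ⊕ Fin n → ℤ :=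
  Sum.elim (fun i => if i = 0 then 1 else 0) (fun i => if i = 0 then -1 else 0)

theorem hVec_val : (hVec n).1 = Matrix.diagonal fun a => (hd n a : ℂ) := by
  ext (i | i) (j | j) <;> simp [hVec, hd, Matrix.single_apply, Matrix.diagonal_apply] <;> grind

theorem eVec_ne : eVec n ≠ 0 := by
  intro h
  have := congrFun (congrFun (congrArg Subtype.val h) (Sum.inl 0)) (Sum.inr 0)
  rw [eVec_val] at this
  simp at this

theorem star_hVec : star (hVec n) = hVec n := by
  apply Subtype.ext
  change (hVec n).1ᴴ = (hVec n).1
  rw [hVec_val, diagonal_conjTranspose]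
  congr 1
  ext a
  simp

theorem lie_eVec (h : SpC n) (hh : h ∈ spCartan n) :
    ⁅h, eVec n⁆ = (2 * h.1 (Sum.inl 0) (Sum.inl 0)) • eVec n := by
  have hr := apply_rr h 0 0
  have hd : ∀ a b, a ≠ b → h.1 a b = 0 := hh
  apply Subtype.ext
  rw [val_lie, eVec_val]
  change _ = (2 * h.1 (Sum.inl 0) (Sum.inl 0)) • (eVec n).1
  rw [eVec_val]
  ext a b
  simp only [Matrix.sub_apply, Matrix.smul_apply, smul_eq_mul]
  by_cases ha : a = Sum.inl 0 <;> by_cases hb : b = Sum.inr 0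
  · subst ha hb
    simp [hr]; ring
  · subst ha
    simp [hb, hd (Sum.inr 0) b (Ne.symm hb), Ne.symm hb]
  · subst hb
    simp [ha, hd a (Sum.inl 0) ha, Ne.symm ha]
  · simp [ha, hb, Ne.symm ha]

theorem pos_eVec (x : SpC n) (hx : x ∈ spPos n) : ⁅x, eVec n⁆ = 0 := by
  have h1 : ∀ i j, x.1 (Sum.inr i) (Sum.inl j) = 0 := hx.1
  have h2 : ∀ i j, j ≤ i → x.1 (Sum.inl i) (Sum.inl j) = 0 := hx.2
  have h3 := apply_rr x
  apply Subtype.ext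
  rw [val_lie, eVec_val]
  ext a b
  have ha : x.1 a (Sum.inl 0) = 0 := by
    rcases a with i | i
    · exact h2 i 0 (Fin.zero_le i)
    · exact h1 i 0
  have hb : x.1 (Sum.inr 0) b = 0 := by
    rcases b with i | i
    · exact h1 0 i
    · rw [h3, h2 i 0 (Fin.zero_le i), neg_zero]
  have e1 : (x.1 * (Matrix.single (Sum.inl 0) (Sum.inr 0) 1 :
      Matrix (Fin n ⊕ Fin n) (Fin n ⊕ Fin n) ℂ)) a b = 0 := by
    by_cases h : b = Sum.inr 0
    · subst h
      simp [ha]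
    · simp [h]
  have e2 : ((Matrix.single (Sum.inl 0) (Sum.inr 0) 1 :
      Matrix (Fin n ⊕ Fin n) (Fin n ⊕ Fin n) ℂ) * x.1) a b = 0 := by
    by_cases h : a = Sum.inl 0
    · subst h
      simp [hb]
    · simp [h]
  exact (congrArg₂ (· - ·) e1 e2).trans (sub_zero 0)

theorem hVec_mem : hVec n ∈ spCartan n := by
  intro a b hab
  rw [hVec_val, diagonal_apply_ne _ hab]

theorem hVec_00 : (hVec n).1 (Sum.inl 0) (Sum.inl 0) = 1 := by
  rw [hVec_val]; simp [hd]

theorem uniq (t : SpC n ⊗[ℂ] SpC n) (ht : ⁅hVec n, t⁆ = (4 : ℂ) • t) :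
    ∃ a : ℂ, t = a • (eVec n ⊗ₜ[ℂ] eVec n) := by
  have h1 := congrArg (ent n) ht
  rw [ent_lie, map_smul] at h1
  have hact : act (hVec n) = Matrix.diagonal fun p => ((hd n p.1 + hd n p.2 : ℤ) : ℂ) := by
    rw [act, hVec_val]
    ext ⟨a, b⟩ ⟨c, d⟩
    by_cases hac : a = c <;> by_cases hbd : b = d <;>
      simp [hac, hbd]
  rw [hact] at h1
  refine ⟨ent n t (Sum.inl 0, Sum.inl 0) (Sum.inr 0, Sum.inr 0), ent_injective ?_⟩
  rw [map_smul, ent_tmul, eVec_val]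
  ext ⟨a, b⟩ ⟨c, d⟩
  have h2 := congrFun (congrFun h1 (a, b)) (c, d)
  simp only [Matrix.sub_apply, diagonal_mul, mul_diagonal, Matrix.smul_apply, smul_eq_mul] at h2
  by_cases h : a = Sum.inl 0 ∧ b = Sum.inl 0 ∧ c = Sum.inr 0 ∧ d = Sum.inr 0
  · obtain ⟨rfl, rfl, rfl, rfl⟩ := h
    simp
  · have hne : hd n a + hd n b - (hd n c + hd n d) ≠ 4 := by
      have q : ∀ a : Fin n ⊕ Fin n, hd n a ≤ 1 ∧ -1 ≤ hd n a ∧ (hd n a = 1 → a = Sum.inl 0) ∧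
          (hd n a = -1 → a = Sum.inr 0) := by
        rintro (i | i) <;> by_cases hi : i = 0 <;> simp [hd, hi]
      have qa := q a
      have qb := q b
      have qc := q c
      have qd := q d
      intro h4
      exact h ⟨qa.2.2.1 (by omega), qb.2.2.1 (by omega), qc.2.2.2 (by omega), qd.2.2.2 (by omega)⟩
    have h0 : ent n t (a, b) (c, d) = 0 := by
      have h3 : (((hd n a + hd n b - (hd n c + hd n d) - 4 : ℤ)) : ℂ) * ent n t (a, b) (c, d) = 0 := by
        push_cast at h2 ⊢
        linear_combination h2
      rcases mul_eq_zero.1 h3 with h5 | h5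
      · exact absurd (Int.cast_eq_zero.1 h5) (by omega)
      · exact h5
    rw [h0]
    simp only [Matrix.smul_apply, kronecker_apply, Matrix.single_apply, smul_eq_mul]
    grind

theorem ee_ne (n : ℕ) [NeZero n] : eVec n ⊗ₜ[ℂ] eVec n ≠ 0 := by
  intro h
  have h1 := congrArg (ent n) h
  rw [ent_tmul, map_zero, eVec_val] at h1
  have := congrFun (congrFun h1 (Sum.inl 0, Sum.inl 0)) (Sum.inr 0, Sum.inr 0)
  simp at this

theorem lie_ee (h : SpC n) (hh : h ∈ spCartan n) :
    ⁅h, eVec n ⊗ₜ[ℂ] eVec n⁆ = (2 * (2 * h.1 (Sum.inl 0) (Sum.inl 0))) • (eVec n ⊗ₜ[ℂ] eVec n) := by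
  rw [TensorProduct.LieModule.lie_tmul_right, lie_eVec h hh, TensorProduct.tmul_smul,
    ← TensorProduct.smul_tmul', ← add_smul]
  congr 1
  ring

theorem pos_ee (x : SpC n) (hx : x ∈ spPos n) : ⁅x, eVec n ⊗ₜ[ℂ] eVec n⁆ = 0 := by
  rw [TensorProduct.LieModule.lie_tmul_right, pos_eVec x hx]
  simp

/-- The highest root. -/
def theta (n : ℕ) [NeZero n] : Module.Dual ℂ (spCartan n) where
  toFun h := 2 * h.1.1 (Sum.inl 0) (Sum.inl 0)
  map_add' X Y := by
    change 2 * (X.1.1 _ _ + Y.1.1 _ _) = _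
    ring
  map_smul' r X := by
    change 2 * (r * X.1.1 _ _) = r * (2 * X.1.1 _ _)
    ring

/-- A highest weight vector of the adjoint representation is a multiple of `eVec`. -/
theorem eq_eVec (v : SpC n) (hv : ∀ x ∈ spPos n, ⁅x, v⁆ = 0) : ∃ c : ℂ, v = c • eVec n := by
  have hB : ∀ (B : Matrix (Fin n) (Fin n) ℂ) (hB : Bᵀ = B),
      fromBlocks 0 B 0 0 * v.1 = v.1 * fromBlocks 0 B 0 0 := by
    intro B hB
    let x : SpC n := ⟨fromBlocks 0 B 0 0, by rw [mem_iff_blocks]; simp [hB]⟩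
    have := hv x ⟨fun i j => rfl, fun i j _ => rfl⟩
    exact sub_eq_zero.1 (congrArg Subtype.val this)
  have hA : ∀ (A : Matrix (Fin n) (Fin n) ℂ) (hA : ∀ i j, j ≤ i → A i j = 0),
      fromBlocks A 0 0 (-Aᵀ) * v.1 = v.1 * fromBlocks A 0 0 (-Aᵀ) := by
    intro A hA
    let x : SpC n := ⟨fromBlocks A 0 0 (-Aᵀ), by rw [mem_iff_blocks]; simp⟩
    have := hv x ⟨fun i j => rfl, fun i j h => hA i j h⟩
    exact sub_eq_zero.1 (congrArg Subtype.val this)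
  have hD := apply_rr v
  have hS := apply_lr v
  obtain ⟨A, B, C, D, hvb⟩ : ∃ A B C D, v.1 = fromBlocks A B C D :=
    ⟨_, _, _, _, (fromBlocks_toBlocks v.1).symm⟩
  rw [hvb] at hA hB hD hS
  simp only [fromBlocks_apply₂₂, fromBlocks_apply₁₁, fromBlocks_apply₁₂] at hD hS
  have hB' : ∀ i, (Matrix.single i i 1 : Matrix (Fin n) (Fin n) ℂ) * C = A * 0 + B * 0 ∧
      Matrix.single i i 1 * D = A * Matrix.single i i 1 ∧
        (0 : Matrix (Fin n) (Fin n) ℂ) = C * Matrix.single i i 1 := by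
    intro i
    have := hB (Matrix.single i i 1) (by simp)
    rw [fromBlocks_multiply, fromBlocks_multiply, fromBlocks_inj] at this
    simpa using this
  have hC0 : ∀ i j, C i j = 0 := by
    intro i j
    have := congrFun (congrFun (hB' j).2.2 i) j
    simpa using this.symm
  have hA0 : ∀ i j, A i j = 0 := by
    intro i j
    have h1 := congrFun (congrFun (hB' j).2.1 i) j
    by_cases hij : i = j
    · subst hij
      simp [hD] at h1
      have : (2 : ℂ) * A i i = 0 := by linear_combination -h1
      simpa using this
    · simpa [Matrix.mul_apply, Matrix.single_apply, hij, Ne.symm hij] using h1.symm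
  have hBz : ∀ i j, ¬ (i = 0 ∧ j = 0) → B i j = 0 := by
    have key : ∀ j k, j ≠ 0 → B j k = 0 := by
      intro j k hj
      have hu : ∀ a b : Fin n, b ≤ a → (Matrix.single 0 j 1 : Matrix (Fin n) (Fin n) ℂ) a b = 0 := by
        intro a b hab
        rw [Matrix.single_apply, if_neg]
        rintro ⟨rfl, rfl⟩
        exact hj (le_antisymm hab (Fin.zero_le _))
      have := hA (Matrix.single 0 j 1) hu
      rw [fromBlocks_multiply, fromBlocks_multiply, fromBlocks_inj] at this
      have h1 := congrFun (congrFun this.2.1 0) k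
      by_cases hk : k = 0
      · subst hk
        simp at h1
        rw [hS 0 j] at h1
        have : (2 : ℂ) * B j 0 = 0 := by linear_combination h1
        simpa using this
      · simpa [Matrix.mul_apply, Matrix.single_apply, hk, Ne.symm hk] using h1
    intro i j hij
    by_cases hi : i = 0
    · rw [hS]
      exact key j i (fun hj => hij ⟨hi, hj⟩)
    · exact key i j hi
  refine ⟨B 0 0, Subtype.ext ?_⟩
  change v.1 = B 0 0 • (eVec n).1
  rw [hvb, eVec_val]
  ext (i | i) (j | j)
  · simp [hA0]
  · by_cases h : i = 0 ∧ j = 0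
    · obtain ⟨rfl, rfl⟩ := h
      simp
    · have : ¬ (0 = i ∧ 0 = j) := fun q => h ⟨q.1.symm, q.2.symm⟩
      simp [hBz i j h, this]
  · simp [hC0]
  · simp [hD, hA0]

/-- The submodule generated by the tensor square of the highest root vector. -/
def gen (n : ℕ) [NeZero n] : LieSubmodule ℂ (SpC n) (SpC n ⊗[ℂ] SpC n) :=
  LieSubmodule.lieSpan ℂ (SpC n) {eVec n ⊗ₜ[ℂ] eVec n}

theorem gen_spec : LieModule.IsIrreducible ℂ (SpC n) (gen n) ∧
    ∃! P : SpC n ⊗[ℂ] SpC n →ₗ⁅ℂ, SpC n⁆ SpC n ⊗[ℂ] SpC n,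
      LinearMap.IsProj (gen n).toSubmodule P := by
  refine lieIrr_of_star (core n) star core_lie _ (ee_ne n) (hVec n) 4 star_hVec ?_ uniq
  rw [lie_ee _ hVec_mem, hVec_00]
  norm_num

theorem isCartanProduct_iff (C : LieSubmodule ℂ (SpC n) (SpC n ⊗[ℂ] SpC n)) :
    IsCartanProduct n C ↔ C = gen n := by
  constructor
  · rintro ⟨hirr, χ, ⟨v, hv0, hv, hvp⟩, ⟨w, hw0, hw, -⟩⟩
    obtain ⟨c, rfl⟩ := eq_eVec v hvp
    have hχ : χ ⟨hVec n, hVec_mem⟩ = 2 := by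
      have h1 := hv ⟨hVec n, hVec_mem⟩
      rw [lie_smul, lie_eVec _ hVec_mem, hVec_00, smul_comm, ← sub_eq_zero, ← sub_smul] at h1
      rcases smul_eq_zero.1 h1 with h2 | h2
      · linear_combination -h2
      · exact absurd h2 hv0
    have h4 : ⁅hVec n, (w : SpC n ⊗[ℂ] SpC n)⁆ = (4 : ℂ) • (w : SpC n ⊗[ℂ] SpC n) := by
      have h1 := congrArg Subtype.val (hw ⟨hVec n, hVec_mem⟩)
      rw [LinearMap.smul_apply, hχ] at h1
      norm_num at h1
      exact h1
    obtain ⟨a, ha⟩ := uniq _ h4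
    have ha0 : a ≠ 0 := by
      rintro rfl
      rw [zero_smul] at ha
      exact hw0 (Subtype.ext ha)
    have hee : eVec n ⊗ₜ[ℂ] eVec n ∈ C := by
      have : eVec n ⊗ₜ[ℂ] eVec n = a⁻¹ • (w : SpC n ⊗[ℂ] SpC n) := by
        rw [ha, smul_smul, inv_mul_cancel₀ ha0, one_smul]
      rw [this]
      exact C.smul_mem _ w.2
    have hle : gen n ≤ C := LieSubmodule.lieSpan_le.2 (by simpa using hee)
    refine le_antisymm (fun u hu => ?_) hle
    have htop : (gen n).comap C.incl = ⊤ := by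
      have := hirr
      refine (eq_bot_or_eq_top _).resolve_left fun hbot => ?_
      have : (⟨_, hee⟩ : C) ∈ (gen n).comap C.incl := by
        rw [LieSubmodule.mem_comap]
        exact LieSubmodule.subset_lieSpan rfl
      rw [hbot, LieSubmodule.mem_bot] at this
      exact ee_ne n (congrArg Subtype.val this)
    have : (⟨u, hu⟩ : C) ∈ (gen n).comap C.incl := htop ▸ LieSubmodule.mem_top _
    exact this
  · rintro rfl
    refine ⟨gen_spec.1, theta n, ⟨eVec n, eVec_ne, fun h => lie_eVec h.1 h.2, pos_eVec⟩,
      ⟨⟨_, LieSubmodule.subset_lieSpan rfl⟩, fun h => ee_ne n (congrArg Subtype.val h), ?_, ?_⟩⟩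
    · intro h
      exact Subtype.ext (lie_ee h.1 h.2)
    · intro x hx
      exact Subtype.ext (pos_ee x hx)

end

end SpAux

/-- For `n ≥ 1` there is exactly one Cartan product. -/
theorem existsUnique_isCartanProduct (n : ℕ) (hn : 1 ≤ n) : ∃! C, IsCartanProduct n C := by
  have : NeZero n := ⟨by omega⟩
  exact ⟨SpAux.gen n, (SpAux.isCartanProduct_iff _).2 rfl,
    fun C hC => (SpAux.isCartanProduct_iff C).1 hC⟩

/-- For `n ≥ 1` there is exactly one invariant projection onto the Cartan product. -/
theorem existsUnique_isCartanProjection (n : ℕ) (hn : 1 ≤ n) : ∃! P, IsCartanProjection n P := by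
  have : NeZero n := ⟨by omega⟩
  obtain ⟨P, hP, hu⟩ := (SpAux.gen_spec (n := n)).2
  refine ⟨P, ⟨SpAux.gen n, (SpAux.isCartanProduct_iff _).2 rfl, hP⟩, ?_⟩
  rintro Q ⟨C, hC, hQ⟩
  rw [SpAux.isCartanProduct_iff] at hC
  subst hC
  exact hu Q hQ

/-- The invariant projection `X ⊗ Y ↦ X ⊛ Y` of `g ⊗ g` onto the Cartan product, for
`g = sp(2n, ℂ)`. -/
def cartanProj (n : ℕ) (hn : 1 ≤ n) : SpC n ⊗[ℂ] SpC n →ₗ⁅ℂ, SpC n⁆ SpC n ⊗[ℂ] SpC n :=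
  (existsUnique_isCartanProjection n hn).choose

theorem cartanProj_spec (n : ℕ) (hn : 1 ≤ n) : IsCartanProjection n (cartanProj n hn) :=
  (existsUnique_isCartanProjection n hn).choose_spec.1

/-- The embedding of `g ⊗ g` in the tensor algebra as its second graded piece. -/
def tensorSquareι (n : ℕ) : SpC n ⊗[ℂ] SpC n →ₗ[ℂ] TensorAlgebra ℂ (SpC n) :=
  TensorProduct.lift
    ((LinearMap.mul ℂ (TensorAlgebra ℂ (SpC n))).compl₁₂ (TensorAlgebra.ι ℂ) (TensorAlgebra.ι ℂ))

/-- The two-sided ideal of the tensor algebra of `g = sp(2n, ℂ)` generated by the elements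
`X ⊗ Y - X ⊛ Y - ½ [X, Y] - lam ⟨X, Y⟩`, where `⟨X, Y⟩` is the Killing form. -/
def josephIdeal (n : ℕ) (hn : 1 ≤ n) (lam : ℂ) : TwoSidedIdeal (TensorAlgebra ℂ (SpC n)) :=
  TwoSidedIdeal.span {z | ∃ X Y : SpC n,
    z = tensorSquareι n (X ⊗ₜ[ℂ] Y) - tensorSquareι n (cartanProj n hn (X ⊗ₜ[ℂ] Y))
      - (1 / 2 : ℂ) • TensorAlgebra.ι ℂ ⁅X, Y⁆
      - algebraMap ℂ (TensorAlgebra ℂ (SpC n)) (lam * killingForm ℂ (SpC n) X Y)}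

end

/-!
Identify `g = sp(2n, ℂ)` with the symmetric square of `V = ℂ²ⁿ`, writing `u v` (`sq n u v` below) for
the element `w ↦ ω(v, w) u + ω(u, w) v`. The Cartan product is then the fourth symmetric power of
`V`, and all that matters about it is that `(u v) ⊛ (w z)` is symmetric in the four vectors
(`cartanProj_middleSwap`). To see this, let `D ⊆ g ⊗ g` be the submodule spanned by the differences
`(u v) ⊗ (w z) - (u w) ⊗ (v z)`. Its image under the projection is a submodule of the irreducible
Cartan product, and it misses the highest weight vector: no nonzero difference of products of basis
vectors has the highest weight, which is attained only by a fourth power. So the image is zero.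

Consequently, in the quotient of the tensor algebra by the ideal, the expression
`X Y - ½ [X, Y] - lam ⟨X, Y⟩` with `X = u v`, `Y = w z` is symmetric in `u, v, w, z`; in particular
the commutator of `X` and `Y` is `[X, Y]`. Here `⟨X, Y⟩ = (2 n + 2) tr (X Y)` (`killingForm_eq`).

As `n ≥ 2`, there are a symplectic pair `u, v` and a vector `w` orthogonal to it. With `h = u v`, the
relations rewrite `w² (u² v²)` as `w² (h² + 2 h - 12 (n + 1) lam)`, while `w² u² = (u w) (u w)` and the
rewriting of `(u w) ((u w) v²)` gives `w² (h² + 2 h + 3 / 4)`. So `w² = 0` in the quotient unless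
`lam = -1 / (16 (n + 1))` (`QuadraticRelations.sq_self_eq_zero`). Every basis vector can serve as `w`,
and the commutators with these squares give all of `g` (`QuadraticRelations.eq_zero`).
-/

noncomputable section

namespace SpTensor

open Matrix SpAux

variable {n : ℕ}

/-! ### The symplectic Lie algebra as a symmetric square -/

/-- The matrices of size `2n`, with rows and columns indexed as in `sp(2n, ℂ)`. -/
abbrev Mat (n : ℕ) : Type := Matrix (Fin n ⊕ Fin n) (Fin n ⊕ Fin n) ℂ

/-- The symplectic form `ω(v, w) = (J v) · w` on `ℂ²ⁿ`. -/
def omega (v w : Fin n ⊕ Fin n → ℂ) : ℂ := (J (Fin n) ℂ *ᵥ v) ⬝ᵥ w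

theorem omega_swap (v w : Fin n ⊕ Fin n → ℂ) : omega w v = -omega v w := by
  rw [omega, omega, dotProduct_comm, dotProduct_mulVec, ← mulVec_transpose, J_transpose,
    neg_mulVec, neg_dotProduct]

@[simp] theorem omega_self (v : Fin n ⊕ Fin n → ℂ) : omega v v = 0 := by
  have := omega_swap v v
  linear_combination this / 2

theorem omega_single (a b : Fin n ⊕ Fin n) :
    omega (Pi.single a 1) (Pi.single b 1) = J (Fin n) ℂ b a := by
  simp [omega]

/-- Twice the projection of the space of all matrices onto `sp(2n, ℂ)` along the eigenspace of
`E ↦ J Eᵀ J` for the eigenvalue `-1`. -/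
def sym (n : ℕ) : Mat n →ₗ[ℂ] SpC n where
  toFun E := ⟨E + J (Fin n) ℂ * Eᵀ * J (Fin n) ℂ, by
    rw [mem_iff]
    simp only [transpose_add, transpose_mul, J_transpose, transpose_transpose, add_mul, mul_add,
      mul_neg, neg_mul, neg_neg, neg_add, mul_assoc, J_squared]
    simp only [← mul_assoc, J_squared]
    simp [add_comm]⟩
  map_add' E F := by
    apply Subtype.ext
    change _ = (E + _) + (F + _)
    simp only [transpose_add, mul_add, add_mul]
    abel
  map_smul' r E := by
    apply Subtype.ext
    change _ = r • (E + _)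
    simp

theorem sym_val (E : Mat n) :
    (sym n E).1 = E + J (Fin n) ℂ * Eᵀ * J (Fin n) ℂ := rfl

theorem J_transpose_J (X : SpC n) : J (Fin n) ℂ * X.1ᵀ * J (Fin n) ℂ = X.1 := by
  rw [mul_assoc, (mem_iff X.1).1 X.2, ← mul_assoc, J_squared]
  simp

theorem sym_coe (X : SpC n) : sym n X.1 = (2 : ℂ) • X := by
  apply Subtype.ext
  rw [sym_val, J_transpose_J]
  exact (two_smul ℂ X.1).symm

/-- The element `w ↦ ω(v, w) u + ω(u, w) v` of `sp(2n, ℂ)`; it is the product `u v` under the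
isomorphism of `sp(2n, ℂ)` with the symmetric square of `ℂ²ⁿ`. -/
def sq (n : ℕ) : (Fin n ⊕ Fin n → ℂ) →ₗ[ℂ] (Fin n ⊕ Fin n → ℂ) →ₗ[ℂ] SpC n :=
  LinearMap.mk₂ ℂ (fun u v => sym n (vecMulVec u (J (Fin n) ℂ *ᵥ v)))
    (fun u u' v => by rw [add_vecMulVec, map_add])
    (fun r u v => by rw [smul_vecMulVec, map_smul])
    (fun u v v' => by rw [mulVec_add, vecMulVec_add, map_add])
    (fun r u v => by rw [mulVec_smul, vecMulVec_smul, map_smul])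

theorem sq_val (u v : Fin n ⊕ Fin n → ℂ) :
    (sq n u v).1 = vecMulVec u (J (Fin n) ℂ *ᵥ v) + vecMulVec v (J (Fin n) ℂ *ᵥ u) := by
  change (sym n _).1 = _
  rw [sym_val, transpose_vecMulVec, mul_vecMulVec, vecMulVec_mul, mulVec_mulVec, J_squared,
    ← mulVec_transpose, J_transpose]
  simp [neg_mulVec, vecMulVec_neg, neg_vecMulVec]

theorem sq_comm (u v : Fin n ⊕ Fin n → ℂ) : sq n u v = sq n v u := by
  apply Subtype.ext
  rw [sq_val, sq_val, add_comm]

theorem sq_mulVec (u v w : Fin n ⊕ Fin n → ℂ) :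
    (sq n u v).1 *ᵥ w = omega v w • u + omega u w • v := by
  rw [sq_val, add_mulVec, vecMulVec_mulVec, vecMulVec_mulVec, op_smul_eq_smul, op_smul_eq_smul]
  rfl

/-- The action of `sp(2n, ℂ)` on itself is the one on the symmetric square of `ℂ²ⁿ`. -/
theorem lie_sq (Y : SpC n) (u v : Fin n ⊕ Fin n → ℂ) :
    ⁅Y, sq n u v⁆ = sq n (Y.1 *ᵥ u) v + sq n u (Y.1 *ᵥ v) := by
  have h : ∀ v : Fin n ⊕ Fin n → ℂ,
      (J (Fin n) ℂ *ᵥ v) ᵥ* Y.1 = -(J (Fin n) ℂ *ᵥ (Y.1 *ᵥ v)) := by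
    intro v
    rw [← mulVec_transpose, mulVec_mulVec, mulVec_mulVec, (mem_iff Y.1).1 Y.2, mul_neg,
      neg_mulVec]
  apply Subtype.ext
  change _ = (sq n (Y.1 *ᵥ u) v).1 + (sq n u (Y.1 *ᵥ v)).1
  rw [val_lie, sq_val, sq_val, sq_val, mul_add, add_mul, mul_vecMulVec, mul_vecMulVec,
    vecMulVec_mul, vecMulVec_mul, h, h, vecMulVec_neg, vecMulVec_neg]
  abel

theorem lie_sq_sq (u v w z : Fin n ⊕ Fin n → ℂ) :
    ⁅sq n u v, sq n w z⁆ = omega v w • sq n u z + omega u w • sq n v z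
      + omega v z • sq n w u + omega u z • sq n w v := by
  rw [lie_sq, sq_mulVec, sq_mulVec]
  simp only [map_add, map_smul, LinearMap.add_apply, LinearMap.smul_apply]
  abel

theorem trace_sq_mul_sq (u v w z : Fin n ⊕ Fin n → ℂ) :
    ((sq n u v).1 * (sq n w z).1).trace
      = -2 * (omega v w * omega u z + omega u w * omega v z) := by
  rw [sq_val w z, mul_add, mul_vecMulVec, mul_vecMulVec, trace_add, trace_vecMulVec,
    trace_vecMulVec, sq_mulVec, sq_mulVec]
  have h : ∀ a b : Fin n ⊕ Fin n → ℂ, a ⬝ᵥ (J (Fin n) ℂ *ᵥ b) = omega b a :=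
    fun a b => dotProduct_comm _ _
  rw [add_dotProduct, add_dotProduct, smul_dotProduct, smul_dotProduct, smul_dotProduct,
    smul_dotProduct]
  simp only [h, smul_eq_mul]
  rw [omega_swap u z, omega_swap v z, omega_swap u w, omega_swap v w]
  ring

/-- The elements `sq u v` span `sp(2n, ℂ)`. -/
theorem eq_zero_of_sq {M : Type*} [AddCommGroup M] [Module ℂ M] (j : SpC n →ₗ[ℂ] M)
    (h : ∀ a b, j (sq n (Pi.single a 1) (Pi.single b 1)) = 0) (X : SpC n) : j X = 0 := by
  have h1 : ∀ u v, j (sq n u v) = 0 := by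
    have : (sq n).compr₂ j = 0 :=
      (Pi.basisFun ℂ (Fin n ⊕ Fin n)).ext fun a => (Pi.basisFun ℂ (Fin n ⊕ Fin n)).ext fun b => by
        simpa using h a b
    exact fun u v => LinearMap.congr_fun (LinearMap.congr_fun this u) v
  have h2 : j ∘ₗ sym n = 0 := by
    refine Matrix.ext_linearMap ℂ fun a b => LinearMap.ext_ring ?_
    have h3 : j (sq n (Pi.single a 1) (J (Fin n) ℂ *ᵥ Pi.single b (-1))) = 0 := h1 _ _
    have h4 : sq n (Pi.single a 1) (J (Fin n) ℂ *ᵥ Pi.single b (-1)) = sym n (single a b 1) := by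
      change sym n _ = _
      rw [mulVec_mulVec, J_squared, neg_mulVec, one_mulVec, ← Pi.single_neg, neg_neg,
        ← single_eq_single_vecMulVec_single]
    rw [h4] at h3
    exact h3
  have h5 : j (sym n X.1) = 0 := LinearMap.congr_fun h2 X.1
  rw [sym_coe, map_smul] at h5
  simpa using h5

/-! ### The Killing form -/

/-- A trace over `sp(2n, ℂ)` as a trace over all matrices: `f` is half of `f ∘ sym` restricted to
`sp(2n, ℂ)`, and `f ∘ sym` has the same trace on the larger space. -/
theorem trace_eq_sum (f : SpC n →ₗ[ℂ] SpC n) :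
    LinearMap.trace ℂ (SpC n) f = 1 / 2 * ∑ a, ∑ b, (f (sym n (single a b 1))).1 a b := by
  have h1 : (2 : ℂ) • f = (f ∘ₗ sym n) ∘ₗ val n := by
    ext X : 1
    change (2 : ℂ) • f X = f (sym n X.1)
    rw [sym_coe, map_smul]
  have h2 : (2 : ℂ) * LinearMap.trace ℂ (SpC n) f
      = LinearMap.trace ℂ _ (val n ∘ₗ (f ∘ₗ sym n)) := by
    rw [LinearMap.trace_comp_comm', ← h1, map_smul, smul_eq_mul]
  rw [LinearMap.trace_eq_matrix_trace ℂ (Matrix.stdBasis ℂ _ _), Matrix.trace,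
    Fintype.sum_prod_type] at h2
  have h3 : ∀ a b, (f (sym n (single a b 1))).1 a b = Matrix.diag (LinearMap.toMatrix
      (Matrix.stdBasis ℂ (Fin n ⊕ Fin n) (Fin n ⊕ Fin n)) (Matrix.stdBasis ℂ _ _)
        (val n ∘ₗ (f ∘ₗ sym n))) (a, b) := by
    intro a b
    rw [diag_apply, LinearMap.toMatrix_apply, stdBasis_eq_single]
    rfl
  simp only [h3]
  rw [← h2]
  ring

theorem sum_mul_single_mul (Z W : Mat n) :
    ∑ a, ∑ b, (Z * single a b 1 * W : Mat n) a b = Z.trace * W.trace := by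
  have : ∀ a b, (Z * single a b 1 * W : Mat n) a b = Z a a * W b b := by
    intro a b
    rw [single_eq_single_vecMulVec_single, mul_vecMulVec, vecMulVec_mul]
    simp [vecMulVec_apply]
  simp only [this, Matrix.trace, diag_apply, Finset.sum_mul_sum]

theorem sum_mul_single_swap_mul (Z W : Mat n) :
    ∑ a, ∑ b, (Z * single b a 1 * W : Mat n) a b = (Z * Wᵀ).trace := by
  have : ∀ a b, (Z * single b a 1 * W : Mat n) a b = Z a b * W a b := by
    intro a b
    rw [single_eq_single_vecMulVec_single, mul_vecMulVec, vecMulVec_mul]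
    simp [vecMulVec_apply]
  simp only [this, Matrix.trace, diag_apply, mul_apply, transpose_apply]

/-- Twice the trace of the compression of `M ↦ Z M W` to `sp(2n, ℂ)`. -/
theorem sum_mul_sym_mul (Z W : Mat n) :
    ∑ a, ∑ b, (Z * (sym n (single a b 1)).1 * W : Mat n) a b
      = Z.trace * W.trace - (Z * (J (Fin n) ℂ * Wᵀ * J (Fin n) ℂ)).trace := by
  have : ∀ a b, (Z * (sym n (single a b 1)).1 * W : Mat n) a b = (Z * single a b 1 * W : Mat n) a b
      + ((Z * J (Fin n) ℂ) * single b a 1 * (J (Fin n) ℂ * W) : Mat n) a b := by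
    intro a b
    rw [sym_val, mul_add, add_mul, transpose_single, Matrix.add_apply]
    simp only [mul_assoc]
  simp only [this, Finset.sum_add_distrib]
  rw [sum_mul_single_mul, sum_mul_single_swap_mul, transpose_mul, J_transpose]
  simp only [mul_neg, trace_neg, mul_assoc]
  ring

/-- The Killing form of `sp(2n, ℂ)` is `2n + 2` times the trace form. -/
theorem killingForm_eq (X Y : SpC n) :
    killingForm ℂ (SpC n) X Y = (2 * n + 2) * (X.1 * Y.1).trace := by
  rw [killingForm_apply_apply, trace_eq_sum]
  have h : ∀ a b, ((LieAlgebra.ad ℂ (SpC n) X ∘ₗ LieAlgebra.ad ℂ (SpC n) Y)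
      (sym n (single a b 1))).1 a b = ((X.1 * Y.1) * (sym n (single a b 1)).1 * 1 : Mat n) a b
        - (X.1 * (sym n (single a b 1)).1 * Y.1 : Mat n) a b
        - (Y.1 * (sym n (single a b 1)).1 * X.1 : Mat n) a b
        + (1 * (sym n (single a b 1)).1 * (Y.1 * X.1) : Mat n) a b := by
    intro a b
    change (X.1 * (Y.1 * _ - _ * Y.1) - (Y.1 * _ - _ * Y.1) * X.1 : Mat n) a b = _
    rw [← Matrix.sub_apply, ← Matrix.sub_apply, ← Matrix.add_apply]
    refine congrFun (congrFun ?_ a) b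
    noncomm_ring
  have h1 : J (Fin n) ℂ * (Y.1 * X.1)ᵀ * J (Fin n) ℂ = -(X.1 * Y.1) := by
    have hX := J_transpose_J X
    have hY := J_transpose_J Y
    have : X.1 * Y.1 = J (Fin n) ℂ * X.1ᵀ * (J (Fin n) ℂ * J (Fin n) ℂ) * Y.1ᵀ * J (Fin n) ℂ := by
      nth_rw 1 [← hX, ← hY]
      simp only [mul_assoc]
    rw [this, J_squared, transpose_mul]
    simp [mul_assoc]
  have hX0 : X.1.trace = 0 := by
    simp [Matrix.trace, apply_rr]
  have hY0 : Y.1.trace = 0 := by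
    simp [Matrix.trace, apply_rr]
  simp only [h, Finset.sum_add_distrib, Finset.sum_sub_distrib, sum_mul_sym_mul, h1, J_transpose_J,
    hX0, hY0]
  rw [trace_mul_comm Y.1 X.1]
  simp [J_squared, Matrix.trace_one]
  ring

theorem killingForm_sq_sq (u v w z : Fin n ⊕ Fin n → ℂ) :
    killingForm ℂ (SpC n) (sq n u v) (sq n w z)
      = -4 * (n + 1) * (omega v w * omega u z + omega u w * omega v z) := by
  rw [killingForm_eq, trace_sq_mul_sq]
  ring

/-! ### Symmetry of the Cartan product -/

/-- The obstruction to symmetry of `sq u v ⊗ sq w z` under exchange of the two middle vectors. -/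
def middleSwap (u v w z : Fin n ⊕ Fin n → ℂ) : SpC n ⊗[ℂ] SpC n :=
  sq n u v ⊗ₜ sq n w z - sq n u w ⊗ₜ sq n v z

theorem lie_middleSwap (Y : SpC n) (u v w z : Fin n ⊕ Fin n → ℂ) :
    ⁅Y, middleSwap u v w z⁆ = middleSwap (Y.1 *ᵥ u) v w z + middleSwap u (Y.1 *ᵥ v) w z
      + middleSwap u v (Y.1 *ᵥ w) z + middleSwap u v w (Y.1 *ᵥ z) := by
  simp only [middleSwap, lie_sub, TensorProduct.LieModule.lie_tmul_right, lie_sq,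
    TensorProduct.add_tmul, TensorProduct.tmul_add]
  abel

/-- The submodule of `g ⊗ g` spanned by the elements `middleSwap u v w z`. -/
def middleSwapSpan (n : ℕ) : LieSubmodule ℂ (SpC n) (SpC n ⊗[ℂ] SpC n) where
  toSubmodule := Submodule.span ℂ {t | ∃ u v w z, t = middleSwap u v w z}
  lie_mem := by
    intro Y t ht
    change t ∈ Submodule.span ℂ _ at ht
    change _ ∈ Submodule.span ℂ _
    induction ht using Submodule.span_induction with
    | mem t ht =>
      obtain ⟨u, v, w, z, rfl⟩ := ht
      rw [lie_middleSwap]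
      have h : ∀ u v w z : Fin n ⊕ Fin n → ℂ, middleSwap u v w z ∈
          Submodule.span ℂ {t | ∃ u v w z : Fin n ⊕ Fin n → ℂ, t = middleSwap u v w z} :=
        fun u v w z => Submodule.subset_span ⟨u, v, w, z, rfl⟩
      exact add_mem (add_mem (add_mem (h _ _ _ _) (h _ _ _ _)) (h _ _ _ _)) (h _ _ _ _)
    | zero => simp
    | add a b _ _ ha hb => rw [lie_add]; exact add_mem ha hb
    | smul r a _ ha => rw [lie_smul]; exact Submodule.smul_mem _ _ ha

theorem middleSwap_mem (u v w z : Fin n ⊕ Fin n → ℂ) : middleSwap u v w z ∈ middleSwapSpan n :=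
  Submodule.subset_span ⟨u, v, w, z, rfl⟩

/-- A linear map that kills `middleSwap` on basis vectors kills it on all vectors. -/
theorem map_middleSwap_eq_zero {M : Type*} [AddCommGroup M] [Module ℂ M]
    (f : SpC n ⊗[ℂ] SpC n →ₗ[ℂ] M)
    (h : ∀ a b c d, f (middleSwap (Pi.single a 1) (Pi.single b 1) (Pi.single c 1)
      (Pi.single d 1)) = 0) (u v w z : Fin n ⊕ Fin n → ℂ) : f (middleSwap u v w z) = 0 := by
  let B := Pi.basisFun ℂ (Fin n ⊕ Fin n)
  let q : (Fin n ⊕ Fin n → ℂ) ⊗[ℂ] (Fin n ⊕ Fin n → ℂ) →ₗ[ℂ] SpC n := TensorProduct.lift (sq n)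
  let e := (TensorProduct.tensorTensorTensorComm ℂ (Fin n ⊕ Fin n → ℂ) (Fin n ⊕ Fin n → ℂ)
    (Fin n ⊕ Fin n → ℂ) (Fin n ⊕ Fin n → ℂ)).toLinearMap
  let g := f ∘ₗ (TensorProduct.map q q - TensorProduct.map q q ∘ₗ e)
  have hg : ∀ u v w z : Fin n ⊕ Fin n → ℂ, g ((u ⊗ₜ v) ⊗ₜ (w ⊗ₜ z)) = f (middleSwap u v w z) := by
    intro u v w z
    simp [g, q, e, middleSwap]
  have h0 : g = 0 := by
    refine ((B.tensorProduct B).tensorProduct (B.tensorProduct B)).ext ?_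
    rintro ⟨⟨a, b⟩, c, d⟩
    simp only [Module.Basis.tensorProduct_apply, hg, B, Pi.basisFun_apply, LinearMap.zero_apply]
    exact h a b c d
  rw [← hg, h0, LinearMap.zero_apply]

section

variable [NeZero n]

/-- The coefficient of the square of the highest root vector. -/
def topCoeff (n : ℕ) [NeZero n] : SpC n ⊗[ℂ] SpC n →ₗ[ℂ] ℂ :=
  Matrix.entryLinearMap ℂ ℂ (Sum.inl 0, Sum.inl 0) (Sum.inr 0, Sum.inr 0) ∘ₗ ent n

theorem topCoeff_apply (t : SpC n ⊗[ℂ] SpC n) :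
    topCoeff n t = ent n t (Sum.inl 0, Sum.inl 0) (Sum.inr 0, Sum.inr 0) := rfl

theorem topCoeff_eVec : topCoeff n (eVec n ⊗ₜ eVec n) = 1 := by
  rw [topCoeff_apply, ent_tmul, eVec_val]
  simp

/-- `topCoeff` vanishes on the weight spaces of `hVec` other than the one of weight `4`. -/
theorem topCoeff_lie (t : SpC n ⊗[ℂ] SpC n) : topCoeff n ⁅hVec n, t⁆ = 4 * topCoeff n t := by
  have hact : act (hVec n) = Matrix.diagonal fun p => ((hd n p.1 + hd n p.2 : ℤ) : ℂ) := by
    rw [act, hVec_val]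
    ext ⟨a, b⟩ ⟨c, d⟩
    by_cases hac : a = c <;> by_cases hbd : b = d <;>
      simp [hac, hbd]
  rw [topCoeff_apply, topCoeff_apply, ent_lie, hact, Matrix.sub_apply, diagonal_mul, mul_diagonal]
  simp [hd]
  ring

theorem hVec_mulVec (a : Fin n ⊕ Fin n) :
    (hVec n).1 *ᵥ Pi.single a 1 = (hd n a : ℂ) • Pi.single a 1 := by
  rw [hVec_val]
  simp [← Pi.single_smul]

theorem hVec_lie_middleSwap (a b c d : Fin n ⊕ Fin n) :
    ⁅hVec n, middleSwap (n := n) (Pi.single a 1) (Pi.single b 1) (Pi.single c 1) (Pi.single d 1)⁆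
      = ((hd n a + hd n b + hd n c + hd n d : ℤ) : ℂ) •
        middleSwap (Pi.single a 1) (Pi.single b 1) (Pi.single c 1) (Pi.single d 1) := by
  rw [lie_middleSwap]
  simp only [hVec_mulVec, middleSwap, map_smul, LinearMap.smul_apply, ← TensorProduct.smul_tmul',
    TensorProduct.tmul_smul, ← smul_sub, ← add_smul]
  push_cast
  rfl

/-- The only product of four basis vectors of weight `4` is a fourth power, which is symmetric. -/
theorem topCoeff_map_middleSwap (P : SpC n ⊗[ℂ] SpC n →ₗ⁅ℂ, SpC n⁆ SpC n ⊗[ℂ] SpC n)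
    (u v w z : Fin n ⊕ Fin n → ℂ) : topCoeff n (P (middleSwap u v w z)) = 0 := by
  refine map_middleSwap_eq_zero (topCoeff n ∘ₗ (P : SpC n ⊗[ℂ] SpC n →ₗ[ℂ] _)) ?_ u v w z
  intro a b c d
  change topCoeff n (P _) = 0
  set t := middleSwap (n := n) (Pi.single a 1) (Pi.single b 1) (Pi.single c 1) (Pi.single d 1)
    with ht
  have h1 : ((hd n a + hd n b + hd n c + hd n d : ℤ) : ℂ) * topCoeff n (P t)
      = 4 * topCoeff n (P t) := by
    rw [← topCoeff_lie, ← P.map_lie, ht, hVec_lie_middleSwap, map_smul, map_smul, smul_eq_mul]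
  by_cases h4 : hd n a + hd n b + hd n c + hd n d = 4
  · have q : ∀ a : Fin n ⊕ Fin n, hd n a ≤ 1 ∧ (hd n a = 1 → a = Sum.inl 0) := by
      rintro (i | i) <;> by_cases hi : i = 0 <;> simp [hd, hi]
    have hb : b = Sum.inl 0 := (q b).2 (by linarith [(q a).1, (q b).1, (q c).1, (q d).1])
    have hc : c = Sum.inl 0 := (q c).2 (by linarith [(q a).1, (q b).1, (q c).1, (q d).1])
    rw [ht, hb, hc, middleSwap, sub_self, map_zero, map_zero]
  · have h2 : ((hd n a + hd n b + hd n c + hd n d - 4 : ℤ) : ℂ) * topCoeff n (P t) = 0 := by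
      push_cast at h1 ⊢
      linear_combination h1
    exact (mul_eq_zero.1 h2).resolve_left (Int.cast_ne_zero.2 (sub_ne_zero.2 h4))

end

/-- The Cartan product `sq u v ⊛ sq w z` is symmetric in the four vectors. The image of
`middleSwapSpan` is a submodule of an irreducible one, and a proper one because `topCoeff` vanishes
on it. -/
theorem cartanProj_middleSwap (hn : 1 ≤ n) (u v w z : Fin n ⊕ Fin n → ℂ) :
    cartanProj n hn (sq n u v ⊗ₜ sq n w z) = cartanProj n hn (sq n u w ⊗ₜ sq n v z) := by
  have : NeZero n := ⟨by omega⟩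
  obtain ⟨C, hC, hP⟩ := cartanProj_spec n hn
  rw [isCartanProduct_iff] at hC
  subst hC
  have hirr := (gen_spec (n := n)).1
  set P := cartanProj n hn
  have hzero : ∀ t ∈ (middleSwapSpan n).map P, topCoeff n t = 0 := by
    intro t ht
    obtain ⟨s, hs, rfl⟩ := (LieSubmodule.mem_map _).1 ht
    change s ∈ Submodule.span ℂ _ at hs
    induction hs using Submodule.span_induction with
    | mem t ht' =>
      obtain ⟨u, v, w, z, rfl⟩ := ht'
      exact topCoeff_map_middleSwap P u v w z
    | zero => simp
    | add a b ha hb iha ihb =>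
      rw [map_add, map_add, iha (LieSubmodule.mem_map_of_mem ha),
        ihb (LieSubmodule.mem_map_of_mem hb), add_zero]
    | smul r a ha iha => rw [map_smul, map_smul, iha (LieSubmodule.mem_map_of_mem ha), smul_zero]
  have hbot : ((middleSwapSpan n).map P).comap (gen n).incl = ⊥ := by
    refine (eq_bot_or_eq_top _).resolve_right fun htop => ?_
    have h1 : (⟨_, LieSubmodule.subset_lieSpan rfl⟩ : gen n) ∈
        ((middleSwapSpan n).map P).comap (gen n).incl := htop ▸ LieSubmodule.mem_top _
    have h2 := hzero _ ((LieSubmodule.mem_comap).1 h1)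
    exact one_ne_zero (topCoeff_eVec.symm.trans h2)
  have h3 : (⟨P (middleSwap u v w z), hP.map_mem _⟩ : gen n) ∈
      ((middleSwapSpan n).map P).comap (gen n).incl :=
    LieSubmodule.mem_comap.2 (LieSubmodule.mem_map_of_mem (middleSwap_mem u v w z))
  rw [hbot, LieSubmodule.mem_bot] at h3
  have h4 : P (middleSwap u v w z) = 0 := congrArg Subtype.val h3
  rw [middleSwap, map_sub] at h4
  exact sub_eq_zero.1 h4

/-! ### Consequences of the quadratic relations -/

section

variable {A : Type*} [Ring A] [Algebra ℂ A] {j : SpC n →ₗ[ℂ] A} {lam : ℂ}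

/-- For `X = sq u v` and `Y = sq w z`, the expression `j X * j Y - ½ j [X, Y] - lam ⟨X, Y⟩` does not
change when `v` and `w` are exchanged. As `sq` is symmetric, this makes it symmetric in the four
vectors, as it is when it depends only on the Cartan product of `X` and `Y`. -/
def QuadraticRelations (j : SpC n →ₗ[ℂ] A) (lam : ℂ) : Prop :=
  ∀ u v w z, j (sq n u v) * j (sq n w z) - (1 / 2 : ℂ) • j ⁅sq n u v, sq n w z⁆
      - algebraMap ℂ A (lam * killingForm ℂ (SpC n) (sq n u v) (sq n w z))
    = j (sq n u w) * j (sq n v z) - (1 / 2 : ℂ) • j ⁅sq n u w, sq n v z⁆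
      - algebraMap ℂ A (lam * killingForm ℂ (SpC n) (sq n u w) (sq n v z))

/-- Exchanging the two pairs of vectors keeps the symmetric expression and changes the sign of the
bracket. -/
theorem QuadraticRelations.commutator (h : QuadraticRelations j lam)
    (u v w z : Fin n ⊕ Fin n → ℂ) :
    j (sq n u v) * j (sq n w z) - j (sq n w z) * j (sq n u v) = j ⁅sq n u v, sq n w z⁆ := by
  have h1 := h u v w z
  have h2 := h w u z v
  rw [sq_comm w u, sq_comm z v, ← h1, ← lie_skew (sq n w z), map_neg, smul_neg,
    LieModule.traceForm_comm ℂ (SpC n) (SpC n) (sq n w z)] at h2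
  have h3 : (1 / 2 : ℂ) • j ⁅sq n u v, sq n w z⁆ + (1 / 2 : ℂ) • j ⁅sq n u v, sq n w z⁆
      = j ⁅sq n u v, sq n w z⁆ := by
    rw [← add_smul]
    norm_num
  linear_combination (norm := abel) h2 + h3

/-- The relation with the Killing form made explicit, doubled to clear the factor `½`. -/
theorem QuadraticRelations.two_mul_mul (h : QuadraticRelations j lam)
    (u v w z : Fin n ⊕ Fin n → ℂ) :
    2 * (j (sq n u v) * j (sq n w z)) - j ⁅sq n u v, sq n w z⁆
      + algebraMap ℂ A (8 * (n + 1) * lam * (omega v w * omega u z + omega u w * omega v z))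
    = 2 * (j (sq n u w) * j (sq n v z)) - j ⁅sq n u w, sq n v z⁆
      + algebraMap ℂ A (8 * (n + 1) * lam * (omega w v * omega u z + omega u v * omega w z)) := by
  have h1 := congrArg (fun x => (2 : ℂ) • x) (h u v w z)
  simp only [killingForm_sq_sq, smul_sub, smul_smul, Algebra.algebraMap_eq_smul_one] at h1 ⊢
  norm_num at h1
  have h2 : ∀ x : A, (2 : ℂ) • x = 2 * x := fun x => by rw [two_smul, two_mul]
  rw [h2, h2] at h1
  convert h1 using 1
  · congr 2
    ring
  · congr 2
    ring

/-- Let `u`, `v` be a symplectic pair and `w` orthogonal to both. Reducing the cubic expression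
`w² u² v² = (u w) (u w) v²` in the two possible ways gives a scalar multiple of `w²`. -/
theorem QuadraticRelations.sq_self_eq_zero (h : QuadraticRelations j lam)
    (hlam : lam ≠ -1 / (16 * ((n : ℂ) + 1))) (u v w : Fin n ⊕ Fin n → ℂ)
    (huv : omega u v = 1) (huw : omega u w = 0) (hvw : omega v w = 0) : j (sq n w w) = 0 := by
  have hvu : omega v u = -1 := by rw [omega_swap u v, huv]
  have hwu : omega w u = 0 := by rw [omega_swap u w, huw, neg_zero]
  have hwv : omega w v = 0 := by rw [omega_swap v w, hvw, neg_zero]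
  have hCA : j (sq n w w) * j (sq n u u) = j (sq n u w) * j (sq n u w) := by
    have := h w w u u
    simpa [killingForm_sq_sq, lie_sq_sq, huw, hwu, sq_comm w u] using this
  have hAP : 2 * (j (sq n u u) * j (sq n v v)) = 2 * (j (sq n u v) * j (sq n u v))
      + 4 * j (sq n u v) + algebraMap ℂ A (-24 * (n + 1) * lam) := by
    have h1 := h.two_mul_mul u u v v
    simp only [lie_sq_sq, huv, hvu, omega_self, sq_comm v u, one_smul, zero_smul, map_add,
      neg_smul, map_neg, map_zero] at h1
    have h2 : algebraMap ℂ A (-24 * (n + 1) * lam)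
        = algebraMap ℂ A (8 * (n + 1) * lam * (-1 * 1 + 1 * 0))
          - algebraMap ℂ A (8 * (n + 1) * lam * (1 * 1 + 1 * 1)) := by
      rw [← map_sub]
      congr 1
      ring
    rw [h2]
    linear_combination (norm := noncomm_ring) h1
  have hBP : 2 * (j (sq n u w) * j (sq n v v))
      = 2 * (j (sq n v w) * j (sq n u v)) + 3 * j (sq n v w) := by
    have h1 := h.two_mul_mul u w v v
    have h2 := h.commutator u v w v
    simp only [lie_sq_sq, huv, huw, hvw, hwv, omega_self, sq_comm w v, one_smul, zero_smul,
      map_add, add_zero, zero_add, mul_zero] at h1 h2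
    linear_combination (norm := noncomm_ring) h1 + 2 * h2
  have hBE : 2 * (j (sq n u w) * j (sq n v w)) = 2 * (j (sq n w w) * j (sq n u v))
      + j (sq n w w) := by
    have h1 := h.two_mul_mul w u w v
    simp only [lie_sq_sq, huv, huw, hwu, hwv, omega_self, sq_comm w v, sq_comm w u, one_smul,
      zero_smul, add_zero, zero_add, mul_zero, zero_mul, map_zero] at h1
    linear_combination (norm := noncomm_ring) h1
  -- Compare `w² (u² v²)` with `(u w) ((u w) v²)`, both times four; the terms `w² (u v)²` and
  -- `w² (u v)` cancel.
  have key : 2 * (j (sq n w w) * algebraMap ℂ A (-24 * (n + 1) * lam)) = 3 * j (sq n w w) := by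
    linear_combination (norm := noncomm_ring) (-2 * j (sq n w w)) * hAP
      + 4 * hCA * j (sq n v v) + 2 * j (sq n u w) * hBP + 2 * hBE * j (sq n u v) + 3 * hBE
  have h5 : (-48 * (n + 1) * lam - 3 : ℂ) • j (sq n w w) = 0 := by
    rw [← Algebra.commutes, ← Algebra.smul_def] at key
    have h6 : (2 : A) = algebraMap ℂ A 2 := (map_ofNat _ 2).symm
    have h7 : (3 : A) = algebraMap ℂ A 3 := (map_ofNat _ 3).symm
    rw [h6, h7, ← Algebra.smul_def, ← Algebra.smul_def, smul_smul, ← sub_eq_zero, ← sub_smul] at key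
    convert key using 2
    ring
  refine (smul_eq_zero.1 h5).resolve_left fun h6 => hlam ?_
  have hn : (n : ℂ) + 1 ≠ 0 := Nat.cast_add_one_ne_zero n
  field_simp
  linear_combination -h6 / 3

/-- The squares of basis vectors vanish, hence so do their commutators with `g`, and these give all
products of two basis vectors. -/
theorem QuadraticRelations.eq_zero (h : QuadraticRelations j lam) (hn : 2 ≤ n)
    (hlam : lam ≠ -1 / (16 * ((n : ℂ) + 1))) (X : SpC n) : j X = 0 := by
  have hself : ∀ a : Fin n ⊕ Fin n, j (sq n (Pi.single a 1) (Pi.single a 1)) = 0 := by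
    intro a
    have : Nontrivial (Fin n) := Fin.nontrivial_iff_two_le.2 hn
    -- `n ≥ 2` leaves room for a symplectic pair orthogonal to the given basis vector.
    obtain ⟨k, hk⟩ := exists_ne (Sum.elim id id a)
    refine h.sq_self_eq_zero hlam (Pi.single (Sum.inl k) 1) (Pi.single (Sum.inr k) 1) _ ?_ ?_ ?_
    · simp [omega_single, J]
    all_goals
      rcases a with i | i <;> simp only [Sum.elim_inl, Sum.elim_inr, id] at hk <;>
        simp [omega_single, J, Ne.symm hk]
  refine eq_zero_of_sq j (fun a b => ?_) X
  -- `a.swap` indexes the basis vector that pairs nontrivially with the one of index `a`.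
  have hs : omega (Pi.single a 1) (Pi.single a.swap 1) ≠ (0 : ℂ) := by
    rcases a with i | i <;> simp [omega_single, J]
  have hc : ∀ w z, j ⁅sq n (Pi.single a 1) (Pi.single a 1), sq n w z⁆ = 0 := by
    intro w z
    rw [← h.commutator, hself, zero_mul, mul_zero, sub_zero]
  by_cases hb : b = a.swap
  · have h1 := hc (Pi.single b 1) (Pi.single b 1)
    rw [lie_sq_sq, sq_comm (Pi.single b 1)] at h1
    rw [← hb] at hs
    simp only [← add_smul, map_smul] at h1
    refine (smul_eq_zero.1 h1).resolve_left fun h2 => hs ?_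
    linear_combination h2 / 4
  · have h0 : omega (Pi.single a 1) (Pi.single b 1) = (0 : ℂ) := by
      rw [omega_single]
      rcases a with i | i <;> rcases b with k | k <;> simp_all [J]
    have h1 := hc (Pi.single a.swap 1) (Pi.single b 1)
    rw [lie_sq_sq, h0, zero_smul, add_zero, add_zero, ← add_smul, map_smul] at h1
    refine (smul_eq_zero.1 h1).resolve_left fun h2 => hs ?_
    linear_combination h2 / 2

end

end SpTensor

end

theorem theorem3 (n : ℕ) (hn : 2 ≤ n) (lam : ℂ) (hlam : lam ≠ -1 / (16 * ((n : ℂ) + 1))) :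
    ∀ X : SpC n, TensorAlgebra.ι ℂ X ∈ josephIdeal n (one_le_two.trans hn) lam := by
  intro X
  let I := josephIdeal n (one_le_two.trans hn) lam
  let π : TensorAlgebra ℂ (SpC n) →+* I.ringCon.Quotient := I.ringCon.mk'
  let j : SpC n →ₗ[ℂ] I.ringCon.Quotient :=
    { toFun := fun X => π (TensorAlgebra.ι ℂ X)
      map_add' := fun X Y => by rw [map_add, map_add]
      map_smul' := fun r X => by rw [map_smul]; rfl }
  have hker : ∀ t, π t = 0 ↔ t ∈ I := fun t => by
    rw [← TwoSidedIdeal.mem_ker, TwoSidedIdeal.ker_ringCon_mk']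
  have hrel : ∀ X Y, π (tensorSquareι n (cartanProj n (one_le_two.trans hn) (X ⊗ₜ Y)))
      = j X * j Y - (1 / 2 : ℂ) • j ⁅X, Y⁆
        - algebraMap ℂ _ (lam * killingForm ℂ (SpC n) X Y) := by
    intro X Y
    have h1 := (hker _).2 (TwoSidedIdeal.subset_span ⟨X, Y, rfl⟩ : _ ∈ I)
    have h2 : tensorSquareι n (X ⊗ₜ Y) = TensorAlgebra.ι ℂ X * TensorAlgebra.ι ℂ Y := rfl
    have h3 : π ((1 / 2 : ℂ) • TensorAlgebra.ι ℂ ⁅X, Y⁆) = (1 / 2 : ℂ) • j ⁅X, Y⁆ := rfl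
    have h4 : ∀ r, π (algebraMap ℂ _ r) = algebraMap ℂ _ r := fun r => rfl
    rw [map_sub, map_sub, map_sub, h2, h3, h4, map_mul] at h1
    change j X * j Y - _ - _ - _ = 0 at h1
    linear_combination (norm := abel) -h1
  have hq : SpTensor.QuadraticRelations j lam := by
    intro u v w z
    rw [← hrel, ← hrel, SpTensor.cartanProj_middleSwap]
  exact (hker _).1 (hq.eq_zero hn hlam X)
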